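/- Let $\mathbb{T}=\mathbb{R}/\mathbb{Z}$, and for $t\in\mathbb{T}$ let $|t|$ denote the distance from $t$ to $0$ in $\mathbb{T}$ (the distance of a representative to the nearest integer). A sequence $(y_n)_{n\ge 1}$ in $\mathbb{T}$ has \emph{Poissonian pair correlation} if for all $s>0$ $$\lim_{N\to\infty}\frac1N\#\Big\{1\le m\ne n\le N:\ |y_m-y_n|\le \frac sN\Big\}=2s,$$ and, for $\alpha\ge 0$, it has \emph{four-fold Poissonian correlation at rate $\alpha$} if for all $s>0$ $$\lim_{N\to\infty}\frac1{N^{4-\alpha}}\#\Big\{1\le m,n,k,l\le N,\ \{m,n\}\ne\{k,l\}:\ |y_m+y_n-y_k-y_l|\le \frac s{N^\alpha}\Big\}=2s.$$ Let $x_1,x_2,\ldots$ be independent random variables, each uniformly distributed on $\mathbb{T}$, and let $$(y_n)_{n\ge1}=(x_1,x_1,x_2,x_2,x_3,x_3,\ldots),\qquad\text{i.e. } y_{2n-1}=y_{2n}=x_n .$$ Then $(y_n)$ has (for every outcome) neither Poissonian pair correlation nor four-fold Poissonian correlation at rate $\alpha=2$, but almost surely $(y_n)$ has four-fold Poissonian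 correlation at rate $\alpha=1$. -/

import Mathlib

open MeasureTheory ProbabilityTheory Filter Topology

noncomputable section

/-- The number of ordered pairs of distinct indices `m ≠ n` among the first `N` terms of `x` with
`|x_m - x_n| ≤ r`. The norm on the circle `ℝ / ℤ` is the distance to the nearest integer.
Sequences are indexed from `0`, so that the first `N` terms are those with index in `Fin N`. -/
def pairCount (x : ℕ → UnitAddCircle) (N : ℕ) (r : ℝ) : ℕ :=
  open Classical in
  (Finset.univ.filter fun p : Fin N × Fin N => p.1 ≠ p.2 ∧ ‖x p.1 - x p.2‖ ≤ r).card

/-- Poissonian pair correlation. -/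
def HasPoissonianPairCorrelation (x : ℕ → UnitAddCircle) : Prop :=
  ∀ s : ℝ, 0 < s →
    Tendsto (fun N : ℕ => (1 / (N : ℝ)) * (pairCount x N (s / (N : ℝ)) : ℝ)) atTop (𝓝 (2 * s))

/-- The number of pairs of `k`-tuples of indices `a, b` among the first `N` indices, such that
`{a_1, …, a_k} ≠ {b_1, …, b_k}` as multisets (that is, `b` is not a rearrangement of `a`)
and `|∑ x_{a_j} - ∑ x_{b_j}| ≤ r`. -/
def foldCount (k : ℕ) (x : ℕ → UnitAddCircle) (N : ℕ) (r : ℝ) : ℕ :=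
  open Classical in
  (Finset.univ.filter fun p : (Fin k → Fin N) × (Fin k → Fin N) =>
    Multiset.map p.1 Finset.univ.val ≠ Multiset.map p.2 Finset.univ.val ∧
      ‖∑ j, x (p.1 j) - ∑ j, x (p.2 j)‖ ≤ r).card

/-- `2k`-fold Poissonian correlation at rate `α`. -/
def HasPoissonianFoldCorrelation (k : ℕ) (α : ℝ) (x : ℕ → UnitAddCircle) : Prop :=
  ∀ s : ℝ, 0 < s →
    Tendsto
      (fun N : ℕ =>
        (1 / (N : ℝ) ^ (2 * (k : ℝ) - α)) * (foldCount k x N (s / (N : ℝ) ^ α) : ℝ))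
      atTop (𝓝 (2 * s))

/-- The sequence `x_0, x_0, x_1, x_1, x_2, x_2, …`. -/
def doubledSeq (x : ℕ → UnitAddCircle) : ℕ → UnitAddCircle := fun n => x (n / 2)

end

/-! The negative parts come from the coincidences `y_{2n-1} = y_{2n}`: at even `N` and every radius
they give at least `N` close pairs and at least `N ^ 2` close admissible quadruples. After
normalisation both quantities are at least 1, while `s = 1/4` would force the limit 1/2.

At rate 1 the normalisation is `N ^ 3`, so such coincidences are negligible. Sum the centred
indicator of the ball of radius `s / N` over all 4-tuples of indices, and expand the second moment
over pairs of tuples, that is, over 8 slots. If some variable occurs in exactly one slot, it makes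
its linear form uniform and independent of the other form, so the term vanishes
(`integral_uniform_add_mul_eq_zero`). Otherwise at most 4 variables occur, which leaves `O(N ^ 4)`
terms (`card_hasNoUniqueValue_half_le`). Divided by `N ^ 6` this is summable, so the normalised sum
tends to 0 almost surely along all `N`. The centring contributes `2 * s`, and the excluded
rearrangements number only `O(N ^ 2)`. -/

/-! ### Counting index tuples without a unique value -/

/-- No value of `g` is taken exactly once. -/
def HasNoUniqueValue {ι β : Type*} (g : ι → β) : Prop :=
  ∀ i, ∃ j, j ≠ i ∧ g j = g i

/-- The linear form `∑ ± x_{g j}`. -/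
def signedSum {ι : Type*} [Fintype ι] (ε : ι → ℤˣ) (g : ι → ℕ) (x : ℕ → UnitAddCircle) :
    UnitAddCircle :=
  ∑ j, ε j • x (g j)

/-- The halves take at most `m` distinct values, so a tuple is determined by `m` representatives, a
label in `Fin m` for each slot, and a parity bit for each slot. -/
theorem card_hasNoUniqueValue_half_le {ι : Type*} [Fintype ι] [Nonempty ι] [DecidableEq ι]
    (m N : ℕ) (hm : Fintype.card ι ≤ 2 * m) (s : Finset (ι → Fin N))
    (hs : ∀ f ∈ s, HasNoUniqueValue fun i => (f i : ℕ) / 2) :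
    s.card ≤ N ^ m * (m ^ Fintype.card ι * 2 ^ Fintype.card ι) := by
  -- The decoder lands in `ℕ` because restoring an arbitrary parity bit may overshoot `N - 1`.
  let Φ : (Fin m → Fin N) × (ι → Fin m) × (ι → Fin 2) → ι → ℕ :=
    fun q i => 2 * ((q.1 (q.2.1 i) : ℕ) / 2) + q.2.2 i
  have hinj : Function.Injective fun (f : ι → Fin N) (i : ι) => (f i : ℕ) := fun f g h => by
    ext i
    exact congrFun h i
  have hsub : s.image (fun f i => (f i : ℕ)) ⊆ Finset.univ.image Φ := by
    intro u hu
    obtain ⟨f, hf, rfl⟩ := Finset.mem_image.1 hu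
    have hrep := hs f hf
    set w : ι → ℕ := fun i => (f i : ℕ) / 2 with hw
    have hcard : (Finset.univ.image w).card ≤ m := by
      -- Every fibre of `w` has at least two elements.
      have h := Finset.mul_card_image_le_card (f := w) Finset.univ 2 (by
        intro b hb
        obtain ⟨i, -, rfl⟩ := Finset.mem_image.1 hb
        obtain ⟨j, hji, hj⟩ := hrep i
        exact Finset.one_lt_card.2 ⟨j, by simpa using hj, i, by simp, hji⟩)
      rw [Finset.card_univ] at h
      omega
    let h : ι → Fin m := fun i =>
      Fin.castLE hcard ((Finset.univ.image w).equivFin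
        ⟨w i, Finset.mem_image_of_mem w (Finset.mem_univ i)⟩)
    have hh : ∀ i j, h i = h j → w i = w j := by
      intro i j hij
      have := (Finset.univ.image w).equivFin.injective (Fin.castLE_injective hcard hij)
      simpa using this
    let i₀ : ι := Classical.arbitrary ι
    classical
    let g : Fin m → Fin N := fun t => if ht : ∃ i, h i = t then f ht.choose else f i₀
    have hg : ∀ i, (g (h i) : ℕ) / 2 = w i := by
      intro i
      have ht : ∃ j, h j = h i := ⟨i, rfl⟩
      simp only [g, dif_pos ht]
      exact hh _ _ ht.choose_spec
    refine Finset.mem_image.2 ⟨(g, h, fun i => ⟨(f i : ℕ) % 2, Nat.mod_lt _ two_pos⟩),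
      Finset.mem_univ _, ?_⟩
    ext i
    simp only [Φ, hg, hw]
    omega
  calc s.card = (s.image fun f i => (f i : ℕ)).card := (Finset.card_image_of_injective s hinj).symm
    _ ≤ (Finset.univ.image Φ).card := Finset.card_le_card hsub
    _ ≤ Fintype.card ((Fin m → Fin N) × (ι → Fin m) × (ι → Fin 2)) := Finset.card_image_le
    _ = _ := by simp

/-! ### Orthogonality from a variable that occurs once -/

theorem measurable_units_smul (e : ℤˣ) : Measurable fun t : UnitAddCircle => e • t := by
  rcases Int.units_eq_one_or e with rfl | rfl
  · simpa using measurable_id'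
  · simpa [Units.smul_def] using measurable_neg

theorem measurable_signedSum {ι : Type*} [Fintype ι] (ε : ι → ℤˣ) (g : ι → ℕ) :
    Measurable (signedSum ε g) :=
  Finset.measurable_fun_sum _ fun j _ =>
    (measurable_units_smul (ε j)).comp (measurable_pi_apply (g j))

theorem hasLaw_units_smul (e : ℤˣ) {Ω : Type*} [MeasurableSpace Ω] {μ : Measure Ω}
    {U : Ω → UnitAddCircle} (hU : HasLaw U (volume : Measure UnitAddCircle) μ) :
    HasLaw (fun ω => e • U ω) (volume : Measure UnitAddCircle) μ := by
  rcases Int.units_eq_one_or e with rfl | rfl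
  · simpa using hU
  · have := (Measure.measurePreserving_neg (volume : Measure UnitAddCircle)).fun_comp_hasLaw hU
    simpa [Units.smul_def] using this

/-- With `(R, V)` fixed, translation invariance makes the integral over `U` equal to `∫ φ = 0`;
Fubini on the product law concludes. -/
theorem integral_uniform_add_mul_eq_zero {Ω : Type*} [MeasurableSpace Ω] {μ : Measure Ω}
    [IsProbabilityMeasure μ] {U R V : Ω → UnitAddCircle}
    (hU : HasLaw U (volume : Measure UnitAddCircle) μ) (hR : AEMeasurable R μ)
    (hV : AEMeasurable V μ) (hind : IndepFun U (fun ω => (R ω, V ω)) μ)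
    {φ ψ : UnitAddCircle → ℝ} (hφ : Measurable φ) (hψ : Measurable ψ)
    (hφ1 : ∀ t, |φ t| ≤ 1) (hψ1 : ∀ t, |ψ t| ≤ 1) (hφ0 : ∫ t, φ t = 0) :
    ∫ ω, φ (U ω + R ω) * ψ (V ω) ∂μ = 0 := by
  have hRV : AEMeasurable (fun ω => (R ω, V ω)) μ := hR.prodMk hV
  have : IsProbabilityMeasure (μ.map fun ω => (R ω, V ω)) := Measure.isProbabilityMeasure_map hRV
  let F : UnitAddCircle × UnitAddCircle × UnitAddCircle → ℝ := fun z => φ (z.1 + z.2.1) * ψ z.2.2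
  have hF : Measurable F := by fun_prop
  have hmap := (indepFun_iff_map_prod_eq_prod_map_map hU.aemeasurable hRV).1 hind
  rw [hU.map_eq] at hmap
  have h1 : ∫ ω, φ (U ω + R ω) * ψ (V ω) ∂μ
      = ∫ z, F z ∂(μ.map fun ω => (U ω, R ω, V ω)) :=
    (integral_map (hU.aemeasurable.prodMk hRV) hF.aestronglyMeasurable).symm
  have hFi : Integrable F ((volume : Measure UnitAddCircle).prod (μ.map fun ω => (R ω, V ω))) := by
    refine Integrable.of_bound hF.aestronglyMeasurable 1 (Eventually.of_forall fun z => ?_)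
    rw [Real.norm_eq_abs, abs_mul]
    exact mul_le_one₀ (hφ1 _) (abs_nonneg _) (hψ1 _)
  rw [h1, hmap, integral_prod_symm _ hFi]
  refine integral_eq_zero_of_ae (Eventually.of_forall fun w => ?_)
  simp only [F, Pi.zero_apply]
  rw [integral_mul_const, integral_add_right_eq_self φ, hφ0, zero_mul]

theorem integral_signedSum_mul_eq_zero {Ω : Type*} [MeasurableSpace Ω] {μ : Measure Ω}
    [IsProbabilityMeasure μ] {X : ℕ → Ω → UnitAddCircle} (hindep : iIndepFun X μ)
    (hunif : ∀ n, HasLaw (X n) (volume : Measure UnitAddCircle) μ)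
    {ι κ : Type*} [Fintype ι] [Fintype κ] [DecidableEq ι] (ε : ι → ℤˣ) (ε' : κ → ℤˣ)
    (g : ι → ℕ) (g' : κ → ℕ) (i : ι) (hi : ∀ j, j ≠ i → g j ≠ g i) (hi' : ∀ j, g' j ≠ g i)
    {φ ψ : UnitAddCircle → ℝ} (hφ : Measurable φ) (hψ : Measurable ψ)
    (hφ1 : ∀ t, |φ t| ≤ 1) (hψ1 : ∀ t, |ψ t| ≤ 1) (hφ0 : ∫ t, φ t = 0) :
    ∫ ω, φ (signedSum ε g fun n => X n ω) * ψ (signedSum ε' g' fun n => X n ω) ∂μ = 0 := by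
  have hX : ∀ n, AEMeasurable (X n) μ := fun n => (hunif n).aemeasurable
  let S : Finset ℕ := (Finset.univ.erase i).image g ∪ Finset.univ.image g'
  have hS : Disjoint ({g i} : Finset ℕ) S := by
    rw [Finset.disjoint_singleton_left]
    simpa [S, not_or] using ⟨fun j hj => hi j hj, hi'⟩
  have hgS : ∀ j ∈ Finset.univ.erase i, g j ∈ S := fun j hj =>
    Finset.mem_union_left _ (Finset.mem_image_of_mem g hj)
  have hgS' : ∀ j, g' j ∈ S := fun j =>
    Finset.mem_union_right _ (Finset.mem_image_of_mem g' (Finset.mem_univ j))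
  have hind := hindep.indepFun_finset₀ {g i} S hS hX
  -- Extension by 0 presents both remaining sums as measurable functions of the variables indexed by
  -- `S`.
  let ext : (S → UnitAddCircle) → ℕ → UnitAddCircle := fun v n => if h : n ∈ S then v ⟨n, h⟩ else 0
  have hext : ∀ n, Measurable fun v => ext v n := by
    intro n
    by_cases h : n ∈ S
    · simp only [ext, dif_pos h]; fun_prop
    · simp only [ext, dif_neg h]; fun_prop
  have hextX : ∀ ω, ∀ n ∈ S, ext (fun n => X n ω) n = X n ω := fun ω n hn => by simp [ext, hn]
  let R : Ω → UnitAddCircle := fun ω => ∑ j ∈ Finset.univ.erase i, ε j • X (g j) ω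
  have key := integral_uniform_add_mul_eq_zero (μ := μ) (U := fun ω => ε i • X (g i) ω) (R := R)
    (V := fun ω => signedSum ε' g' fun n => X n ω)
    (hasLaw_units_smul (ε i) (hunif (g i)))
    (Finset.aemeasurable_fun_sum _ fun j _ => (measurable_units_smul (ε j)).comp_aemeasurable (hX (g j)))
    (Finset.aemeasurable_fun_sum _ fun j _ => (measurable_units_smul (ε' j)).comp_aemeasurable (hX (g' j)))
    (by
      have h := hind.comp (φ := fun v : ({g i} : Finset ℕ) → UnitAddCircle =>
          ε i • v ⟨g i, Finset.mem_singleton_self _⟩)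
        (ψ := fun v : S → UnitAddCircle =>
          (∑ j ∈ Finset.univ.erase i, ε j • ext v (g j), ∑ j, ε' j • ext v (g' j)))
        ((measurable_units_smul _).comp (measurable_pi_apply _))
        ((Finset.measurable_fun_sum _ fun j _ => (measurable_units_smul (ε j)).comp (hext (g j))).prodMk
          (Finset.measurable_fun_sum _ fun j _ => (measurable_units_smul (ε' j)).comp (hext (g' j))))
      convert h using 1
      · rfl
      funext ω
      refine Prod.ext ?_ ?_
      · exact Finset.sum_congr rfl fun j hj => by rw [hextX ω _ (hgS j hj)]
      · exact Finset.sum_congr rfl fun j _ => by rw [hextX ω _ (hgS' j)])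
    hφ hψ hφ1 hψ1 hφ0
  rw [← key]
  congr 1
  ext ω
  rw [signedSum, ← Finset.add_sum_erase _ _ (Finset.mem_univ i)]

/-! ### Second moments and almost sure convergence -/

/-- The sum of the squares has finite integral, hence is almost surely finite, and its terms tend to
0. -/
theorem ae_tendsto_zero_of_summable_integral_sq {Ω : Type*} [MeasurableSpace Ω] {μ : Measure Ω}
    {Y : ℕ → Ω → ℝ} (hY : ∀ n, Integrable (fun ω => Y n ω ^ 2) μ)
    (hsum : Summable fun n => ∫ ω, Y n ω ^ 2 ∂μ) :
    ∀ᵐ ω ∂μ, Tendsto (fun n => Y n ω) atTop (𝓝 0) := by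
  have hm : ∀ n, AEMeasurable (fun ω => ENNReal.ofReal (Y n ω ^ 2)) μ := fun n =>
    (hY n).aemeasurable.ennreal_ofReal
  have hfin : ∫⁻ ω, ∑' n, ENNReal.ofReal (Y n ω ^ 2) ∂μ ≠ ⊤ := by
    rw [lintegral_tsum hm]
    simp_rw [← ofReal_integral_eq_lintegral_ofReal (hY _) (Eventually.of_forall fun _ => sq_nonneg _)]
    exact hsum.tsum_ofReal_ne_top
  filter_upwards [ae_lt_top' (AEMeasurable.tsum hm) hfin] with ω hω
  have h := (ENNReal.tendsto_toReal ENNReal.zero_ne_top).comp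
    (ENNReal.tendsto_atTop_zero_of_tsum_ne_top hω.ne)
  have h2 : Tendsto (fun n => Y n ω ^ 2) atTop (𝓝 0) := by
    simpa [Function.comp_def, ENNReal.toReal_ofReal (sq_nonneg _)] using h
  have h3 := h2.sqrt
  simp only [Real.sqrt_sq_eq_abs, Real.sqrt_zero] at h3
  exact (tendsto_zero_iff_abs_tendsto_zero _).2 h3

theorem integral_signedSum_mul_eq_zero_of_not_hasNoUniqueValue {Ω : Type*} [MeasurableSpace Ω]
    {μ : Measure Ω} [IsProbabilityMeasure μ] {X : ℕ → Ω → UnitAddCircle} (hindep : iIndepFun X μ)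
    (hunif : ∀ n, HasLaw (X n) (volume : Measure UnitAddCircle) μ)
    {ι κ : Type*} [Fintype ι] [Fintype κ] [DecidableEq ι] [DecidableEq κ]
    (ε : ι → ℤˣ) (ε' : κ → ℤˣ) (g : ι → ℕ) (g' : κ → ℕ)
    (hg : ¬ HasNoUniqueValue (Sum.elim g g'))
    {φ : UnitAddCircle → ℝ} (hφ : Measurable φ) (hφ1 : ∀ t, |φ t| ≤ 1) (hφ0 : ∫ t, φ t = 0) :
    ∫ ω, φ (signedSum ε g fun n => X n ω) * φ (signedSum ε' g' fun n => X n ω) ∂μ = 0 := by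
  simp only [HasNoUniqueValue, not_forall, not_exists, not_and] at hg
  obtain ⟨i | i, hi⟩ := hg
  · exact integral_signedSum_mul_eq_zero hindep hunif ε ε' g g' i
      (fun j hj => hi (.inl j) (by simpa using hj)) (fun j => hi (.inr j) (by simp))
      hφ hφ hφ1 hφ1 hφ0
  · simp_rw [mul_comm (φ (signedSum ε g _))]
    exact integral_signedSum_mul_eq_zero hindep hunif ε' ε g' g i
      (fun j hj => hi (.inr j) (by simpa using hj)) (fun j => hi (.inl j) (by simp))
      hφ hφ hφ1 hφ1 hφ0

theorem integrable_sum_signedSum_sq {Ω : Type*} [MeasurableSpace Ω]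
    {μ : Measure Ω} [IsProbabilityMeasure μ] {X : ℕ → Ω → UnitAddCircle}
    (hX : ∀ n, AEMeasurable (X n) μ) {ι α : Type*} [Fintype ι] [Fintype α] (ε : ι → ℤˣ)
    (g : α → ι → ℕ) {φ : UnitAddCircle → ℝ} (hφ : Measurable φ) (hφ1 : ∀ t, |φ t| ≤ 1) :
    Integrable (fun ω => (∑ a, φ (signedSum ε (g a) fun n => X n ω)) ^ 2) μ := by
  have hm : ∀ a, AEMeasurable (fun ω => φ (signedSum ε (g a) fun n => X n ω)) μ := fun a =>
    (hφ.comp (measurable_signedSum ε (g a))).comp_aemeasurable (aemeasurable_pi_lambda _ hX)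
  refine Integrable.of_bound
    ((Finset.aemeasurable_fun_sum _ fun a _ => hm a).pow_const 2).aestronglyMeasurable
    ((Fintype.card α : ℝ) ^ 2) (Eventually.of_forall fun ω => ?_)
  rw [norm_pow, Real.norm_eq_abs]
  gcongr
  calc _ ≤ ∑ a, |φ (signedSum ε (g a) fun n => X n ω)| := Finset.abs_sum_le_sum_abs _ _
    _ ≤ ∑ a : α, 1 := Finset.sum_le_sum fun a _ => hφ1 _
    _ = _ := by simp

/-- Only pairs of tuples whose concatenation has no unique half survive in the expanded square, and
each contributes at most 1. The constant is uniform in `N` and `φ`, so `φ` may vary with `N`. -/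
theorem integral_sum_signedSum_sq_le {Ω : Type*} [MeasurableSpace Ω]
    {μ : Measure Ω} [IsProbabilityMeasure μ] {X : ℕ → Ω → UnitAddCircle} (hindep : iIndepFun X μ)
    (hunif : ∀ n, HasLaw (X n) (volume : Measure UnitAddCircle) μ)
    {ι : Type*} [Fintype ι] [DecidableEq ι] [Nonempty ι] (ε : ι → ℤˣ) :
    ∃ C : ℝ, ∀ (N : ℕ) (φ : UnitAddCircle → ℝ), Measurable φ → (∀ t, |φ t| ≤ 1) →
      ∫ t, φ t = 0 →
      ∫ ω, (∑ f : ι → Fin N, φ (signedSum ε (fun i => (f i : ℕ) / 2) fun n => X n ω)) ^ 2 ∂μ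
        ≤ C * (N : ℝ) ^ Fintype.card ι := by
  classical
  refine ⟨((Fintype.card ι ^ Fintype.card (ι ⊕ ι) * 2 ^ Fintype.card (ι ⊕ ι) : ℕ) : ℝ),
    fun N φ hφ hφ1 hφ0 => ?_⟩
  have hX : ∀ n, AEMeasurable (X n) μ := fun n => (hunif n).aemeasurable
  let h : (ι → Fin N) → ι → ℕ := fun f i => (f i : ℕ) / 2
  let Z : (ι → Fin N) → Ω → ℝ := fun f ω => φ (signedSum ε (h f) fun n => X n ω)
  have hZm : ∀ f, AEMeasurable (Z f) μ := fun f =>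
    (hφ.comp (measurable_signedSum ε (h f))).comp_aemeasurable (aemeasurable_pi_lambda _ hX)
  have hZ1 : ∀ f f' ω, ‖Z f ω * Z f' ω‖ ≤ 1 := fun f f' ω => by
    rw [Real.norm_eq_abs, abs_mul]
    exact mul_le_one₀ (hφ1 _) (abs_nonneg _) (hφ1 _)
  have hZi : ∀ p : (ι → Fin N) × (ι → Fin N), Integrable (fun ω => Z p.1 ω * Z p.2 ω) μ := fun p =>
    Integrable.of_bound ((hZm p.1).mul (hZm p.2)).aestronglyMeasurable 1
      (Eventually.of_forall fun ω => hZ1 _ _ ω)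
  let bad := Finset.univ.filter fun p : (ι → Fin N) × (ι → Fin N) =>
    HasNoUniqueValue (Sum.elim (h p.1) (h p.2))
  have hbad : bad.card ≤ N ^ Fintype.card ι *
      (Fintype.card ι ^ Fintype.card (ι ⊕ ι) * 2 ^ Fintype.card (ι ⊕ ι)) := by
    have hinj : Function.Injective fun p : (ι → Fin N) × (ι → Fin N) => Sum.elim p.1 p.2 :=
      (Equiv.sumArrowEquivProdArrow ι ι (Fin N)).symm.injective
    rw [← Finset.card_image_of_injective bad hinj]
    refine card_hasNoUniqueValue_half_le _ N (by simp [two_mul]) _ fun f hf => ?_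
    obtain ⟨p, hp, rfl⟩ := Finset.mem_image.1 hf
    convert (Finset.mem_filter.1 hp).2 using 1
    ext (i | i) <;> rfl
  calc ∫ ω, (∑ f, Z f ω) ^ 2 ∂μ
      = ∫ ω, ∑ p : (ι → Fin N) × (ι → Fin N), Z p.1 ω * Z p.2 ω ∂μ := by
        congr 1
        ext ω
        rw [sq, Finset.sum_mul_sum, Fintype.sum_prod_type]
    _ = ∑ p : (ι → Fin N) × (ι → Fin N), ∫ ω, Z p.1 ω * Z p.2 ω ∂μ :=
        integral_finsetSum _ fun p _ => hZi p
    _ ≤ ∑ p : (ι → Fin N) × (ι → Fin N),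
          if HasNoUniqueValue (Sum.elim (h p.1) (h p.2)) then (1 : ℝ) else 0 := by
        refine Finset.sum_le_sum fun p _ => ?_
        split_ifs with hp
        · calc _ ≤ ∫ _, (1 : ℝ) ∂μ := integral_mono (hZi p) (integrable_const 1) fun ω =>
                (le_abs_self _).trans (hZ1 _ _ ω)
            _ = 1 := by simp
        · exact (integral_signedSum_mul_eq_zero_of_not_hasNoUniqueValue hindep hunif ε ε _ _ hp
            hφ hφ1 hφ0).le
    _ = (bad.card : ℝ) := by rw [Finset.sum_boole]
    _ ≤ _ := by
        rw [mul_comm]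
        exact_mod_cast hbad

/-! ### From the correlation count to centred sums -/

/-- The signs of the form `∑ x_{a_j} - ∑ x_{b_j}`. -/
def differenceSigns (k : ℕ) : Fin k ⊕ Fin k → ℤˣ := Sum.elim (fun _ => 1) (fun _ => -1)

theorem sum_doubledSeq_sub_sum_eq_signedSum {k N : ℕ} (x : ℕ → UnitAddCircle)
    (f : Fin k ⊕ Fin k → Fin N) :
    ∑ j, doubledSeq x (f (.inl j)) - ∑ j, doubledSeq x (f (.inr j))
      = signedSum (differenceSigns k) (fun i => (f i : ℕ) / 2) x := by
  simp [signedSum, differenceSigns, doubledSeq, Fintype.sum_sum_type, Units.smul_def,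
    sub_eq_add_neg]

/-- The indicator of the closed ball of radius `r` around `0`, minus its mean. -/
noncomputable def centeredBall (r : ℝ) (t : UnitAddCircle) : ℝ :=
  (Metric.closedBall 0 r).indicator 1 t - min 1 (2 * r)

theorem measurable_centeredBall (r : ℝ) : Measurable (centeredBall r) :=
  (measurable_one.indicator measurableSet_closedBall).sub_const _

theorem abs_centeredBall_le {r : ℝ} (hr : 0 ≤ r) (t : UnitAddCircle) : |centeredBall r t| ≤ 1 := by
  have h0 : 0 ≤ min 1 (2 * r) := le_min zero_le_one (by positivity)
  have h1 : min 1 (2 * r) ≤ 1 := min_le_left _ _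
  rw [centeredBall, abs_le]
  by_cases ht : t ∈ Metric.closedBall (0 : UnitAddCircle) r
  · rw [Set.indicator_of_mem ht, Pi.one_apply]
    constructor <;> linarith
  · rw [Set.indicator_of_notMem ht]
    constructor <;> linarith

theorem integral_centeredBall {r : ℝ} (hr : 0 ≤ r) : ∫ t, centeredBall r t = 0 := by
  have h0 : 0 ≤ min 1 (2 * r) := le_min zero_le_one (by positivity)
  have hi : Integrable ((Metric.closedBall (0 : UnitAddCircle) r).indicator (1 : UnitAddCircle → ℝ)) :=
    (integrable_const (1 : ℝ)).indicator measurableSet_closedBall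
  unfold centeredBall
  rw [integral_sub hi (integrable_const _), integral_indicator_one measurableSet_closedBall,
    Measure.real, AddCircle.volume_closedBall, ENNReal.toReal_ofReal h0]
  simp [Measure.real]

/-- The displayed difference is exactly the number of close pairs `(a, b)` with `b` a rearrangement
of `a`. There every index occurs on both sides, so no half is unique and the counting lemma applies.
-/
theorem sum_centeredBall_sub_foldCount_mem_Icc (k : ℕ) [NeZero k] :
    ∃ C : ℝ, ∀ (x : ℕ → UnitAddCircle) (N : ℕ) (r : ℝ),
      (∑ f : Fin k ⊕ Fin k → Fin N,
          centeredBall r (signedSum (differenceSigns k) (fun i => (f i : ℕ) / 2) x))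
        + (N : ℝ) ^ (2 * k) * min 1 (2 * r) - foldCount k (doubledSeq x) N r
        ∈ Set.Icc 0 (C * (N : ℝ) ^ k) := by
  classical
  refine ⟨((k ^ Fintype.card (Fin k ⊕ Fin k) * 2 ^ Fintype.card (Fin k ⊕ Fin k) : ℕ) : ℝ),
    fun x N r => ?_⟩
  let e := Equiv.sumArrowEquivProdArrow (Fin k) (Fin k) (Fin N)
  let near : (Fin k → Fin N) × (Fin k → Fin N) → Prop := fun p =>
    ‖∑ j, doubledSeq x (p.1 j) - ∑ j, doubledSeq x (p.2 j)‖ ≤ r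
  let perm : (Fin k → Fin N) × (Fin k → Fin N) → Prop := fun p =>
    Multiset.map p.1 Finset.univ.val = Multiset.map p.2 Finset.univ.val
  have hsum : (∑ f : Fin k ⊕ Fin k → Fin N,
      centeredBall r (signedSum (differenceSigns k) (fun i => (f i : ℕ) / 2) x))
        + (N : ℝ) ^ (2 * k) * min 1 (2 * r)
      = ((Finset.univ.filter near).card : ℝ) := by
    have hcard : (Fintype.card (Fin k ⊕ Fin k → Fin N) : ℝ) = (N : ℝ) ^ (2 * k) := by
      simp [two_mul]
    simp only [centeredBall, Finset.sum_sub_distrib, Finset.sum_const, Finset.card_univ,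
      nsmul_eq_mul, hcard, sub_add_cancel]
    rw [← Finset.sum_boole, ← e.sum_comp fun p => if near p then (1 : ℝ) else 0]
    refine Finset.sum_congr rfl fun f _ => ?_
    rw [← sum_doubledSeq_sub_sum_eq_signedSum, Set.indicator_apply, mem_closedBall_zero_iff]
    rfl
  have hsplit : (Finset.univ.filter near).card
      = (Finset.univ.filter fun p => near p ∧ perm p).card + foldCount k (doubledSeq x) N r := by
    have h := Finset.card_filter_add_card_filter_not (s := Finset.univ.filter near) perm
    rw [Finset.filter_filter, Finset.filter_filter] at h
    rw [← h, foldCount]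
    congr 2
    ext p
    simp [near, perm, and_comm]
  have hperm : (Finset.univ.filter fun p => near p ∧ perm p).card
      ≤ N ^ k * (k ^ Fintype.card (Fin k ⊕ Fin k) * 2 ^ Fintype.card (Fin k ⊕ Fin k)) := by
    rw [← Finset.card_image_of_injective _ e.symm.injective]
    refine card_hasNoUniqueValue_half_le _ N (by simp [two_mul]) _ fun f hf => ?_
    obtain ⟨p, hp, rfl⟩ := Finset.mem_image.1 hf
    have hp' : perm p := (Finset.mem_filter.1 hp).2.2
    rintro (i | i)
    · have : p.1 i ∈ Multiset.map p.2 Finset.univ.val := by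
        rw [← hp']
        exact Multiset.mem_map_of_mem _ (Finset.mem_univ i)
      obtain ⟨j, -, hj⟩ := Multiset.mem_map.1 this
      exact ⟨.inr j, by simp, by simp [e, Equiv.sumArrowEquivProdArrow, hj]⟩
    · have : p.2 i ∈ Multiset.map p.1 Finset.univ.val := by
        rw [hp']
        exact Multiset.mem_map_of_mem _ (Finset.mem_univ i)
      obtain ⟨j, -, hj⟩ := Multiset.mem_map.1 this
      exact ⟨.inl j, by simp, by simp [e, Equiv.sumArrowEquivProdArrow, hj]⟩
  rw [hsum, hsplit]
  push_cast
  rw [add_sub_cancel_right]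
  refine ⟨by positivity, ?_⟩
  rw [mul_comm]
  exact_mod_cast hperm

/-! ### The almost sure limit at rate one -/

theorem foldCount_mono (k : ℕ) (x : ℕ → UnitAddCircle) (N : ℕ) : Monotone (foldCount k x N) := by
  intro r r' h
  unfold foldCount
  refine Finset.card_le_card fun p => ?_
  simp only [Finset.mem_filter, Finset.mem_univ, true_and]
  exact fun hp => ⟨hp.1, hp.2.trans h⟩

/-- Monotonicity in `s` squeezes real `s` between rationals, so a single null set serves every `s`.
-/
theorem hasPoissonianFoldCorrelation_of_rat {k : ℕ} {α : ℝ} {x : ℕ → UnitAddCircle}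
    (h : ∀ q : ℚ, 0 < q →
      Tendsto (fun N : ℕ => (1 / (N : ℝ) ^ (2 * (k : ℝ) - α)) *
        (foldCount k x N ((q : ℝ) / (N : ℝ) ^ α) : ℝ)) atTop (𝓝 (2 * q))) :
    HasPoissonianFoldCorrelation k α x := by
  intro s hs
  have hmono : ∀ (N : ℕ) (a b : ℝ), a ≤ b →
      (1 / (N : ℝ) ^ (2 * (k : ℝ) - α)) * (foldCount k x N (a / (N : ℝ) ^ α) : ℝ)
      ≤ (1 / (N : ℝ) ^ (2 * (k : ℝ) - α)) * (foldCount k x N (b / (N : ℝ) ^ α) : ℝ) := by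
    intro N a b hab
    refine mul_le_mul_of_nonneg_left ?_ (by positivity)
    exact_mod_cast foldCount_mono k x N (by gcongr)
  rw [tendsto_order]
  constructor
  · intro a ha
    obtain ⟨q, hq1, hq2⟩ := exists_rat_btwn (max_lt (by linarith : a / 2 < s) hs)
    rw [max_lt_iff] at hq1
    filter_upwards [(tendsto_order.1 (h q (by exact_mod_cast hq1.2))).1 a (by linarith)] with N hN
    exact hN.trans_le (hmono N _ _ hq2.le)
  · intro b hb
    obtain ⟨q, hq1, hq2⟩ := exists_rat_btwn (by linarith : s < b / 2)
    filter_upwards [(tendsto_order.1 (h q (by exact_mod_cast hs.trans hq1))).2 b (by linarith)]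
      with N hN
    exact (hmono N _ _ hq1.le).trans_lt hN

theorem ae_tendsto_foldCount_doubledSeq {Ω : Type*} [MeasurableSpace Ω] {μ : Measure Ω}
    [IsProbabilityMeasure μ] {X : ℕ → Ω → UnitAddCircle} (hindep : iIndepFun X μ)
    (hunif : ∀ n, HasLaw (X n) (volume : Measure UnitAddCircle) μ) {s : ℝ} (hs : 0 < s) :
    ∀ᵐ ω ∂μ, Tendsto (fun N : ℕ => (1 / (N : ℝ) ^ (2 * ((2 : ℕ) : ℝ) - 1)) *
      (foldCount 2 (doubledSeq fun n => X n ω) N (s / (N : ℝ) ^ (1 : ℝ)) : ℝ))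
      atTop (𝓝 (2 * s)) := by
  have hX : ∀ n, AEMeasurable (X n) μ := fun n => (hunif n).aemeasurable
  let D : ℕ → Ω → ℝ := fun N ω => ∑ f : Fin 2 ⊕ Fin 2 → Fin N,
    centeredBall (s / N) (signedSum (differenceSigns 2) (fun i => (f i : ℕ) / 2) fun n => X n ω)
  have hr : ∀ N : ℕ, 0 ≤ s / (N : ℝ) := fun N => by positivity
  obtain ⟨C, hC⟩ := integral_sum_signedSum_sq_le hindep hunif (differenceSigns 2)
  obtain ⟨C', hC'⟩ := sum_centeredBall_sub_foldCount_mem_Icc 2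
  have hD : ∀ N, ∫ ω, D N ω ^ 2 ∂μ ≤ C * (N : ℝ) ^ 4 := fun N => by
    simpa using hC N _ (measurable_centeredBall _) (abs_centeredBall_le (hr N))
      (integral_centeredBall (hr N))
  have hlim : ∀ᵐ ω ∂μ, Tendsto (fun N : ℕ => D N ω / (N : ℝ) ^ 3) atTop (𝓝 0) := by
    refine ae_tendsto_zero_of_summable_integral_sq (fun N => ?_) ?_
    · simp_rw [div_pow]
      exact (integrable_sum_signedSum_sq hX _ _ (measurable_centeredBall _)
        (abs_centeredBall_le (hr N))).div_const _
    -- The second moment `C * N ^ 4` is divided by `(N ^ 3) ^ 2`.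
    · have hsum : Summable fun N : ℕ => C * (1 / (N : ℝ) ^ 2) :=
        (Real.summable_one_div_nat_pow.2 one_lt_two).mul_left C
      refine hsum.of_nonneg_of_le (fun N => integral_nonneg fun ω => sq_nonneg _) fun N => ?_
      simp_rw [div_pow]
      rw [integral_div]
      rcases N.eq_zero_or_pos with rfl | hN
      · simp
      · have hN' : (0 : ℝ) < N := by exact_mod_cast hN
        rw [div_le_iff₀ (by positivity)]
        refine (hD N).trans_eq ?_
        field_simp
  filter_upwards [hlim] with ω hω
  let E : ℕ → ℝ := fun N => D N ω + (N : ℝ) ^ 4 * min 1 (2 * (s / N))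
    - foldCount 2 (doubledSeq fun n => X n ω) N (s / N)
  have hE : ∀ N : ℕ, E N ∈ Set.Icc 0 (C' * (N : ℝ) ^ 2) := fun N => hC' _ N _
  have hElim : Tendsto (fun N : ℕ => E N / (N : ℝ) ^ 3) atTop (𝓝 0) := by
    have hC0 : Tendsto (fun N : ℕ => C' / (N : ℝ)) atTop (𝓝 0) :=
      tendsto_const_div_atTop_nhds_zero_nat C'
    refine squeeze_zero' (Eventually.of_forall fun N => div_nonneg (hE N).1 (by positivity)) ?_ hC0
    filter_upwards [eventually_gt_atTop 0] with N hN
    have hN' : (0 : ℝ) < N := by exact_mod_cast hN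
    rw [div_le_iff₀ (by positivity)]
    refine (hE N).2.trans_eq ?_
    field_simp
  have hfinal := (hω.add_const (2 * s)).sub hElim
  rw [zero_add, sub_zero] at hfinal
  refine hfinal.congr' ?_
  -- For `N ≥ 2 * s` the ball does not exceed the circle, so its measure is exactly `2 * s / N`.
  filter_upwards [eventually_gt_atTop 0, eventually_ge_atTop ⌈2 * s⌉₊] with N hN hNs
  have hN' : (0 : ℝ) < N := by exact_mod_cast hN
  have hmin : min 1 (2 * (s / (N : ℝ))) = 2 * (s / N) := by
    refine min_eq_right ?_
    rw [← mul_div_assoc, div_le_one hN']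
    exact Nat.ceil_le.1 hNs
  have hpow : (N : ℝ) ^ (2 * ((2 : ℕ) : ℝ) - 1) = (N : ℝ) ^ 3 := by
    rw [← Real.rpow_natCast]
    norm_num
  simp only [E, hmin, hpow, Real.rpow_one]
  field_simp
  ring

/-! ### Lower bounds from coincident terms -/

theorem le_pairCount_doubledSeq (x : ℕ → UnitAddCircle) (M : ℕ) {r : ℝ} (hr : 0 ≤ r) :
    2 * M ≤ pairCount (doubledSeq x) (2 * M) r := by
  classical
  -- `σ` swaps the two indices `2 * n` and `2 * n + 1` that carry the same variable.
  let σ : Fin (2 * M) → Fin (2 * M) := fun i =>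
    ⟨2 * ((i : ℕ) / 2) + (1 - (i : ℕ) % 2), by have := i.2; omega⟩
  have hinj : Function.Injective fun i : Fin (2 * M) => (i, σ i) := fun i j h => congrArg Prod.fst h
  calc 2 * M = (Finset.univ.image fun i : Fin (2 * M) => (i, σ i)).card := by
        rw [Finset.card_image_of_injective _ hinj, Finset.card_univ, Fintype.card_fin]
    _ ≤ _ := by
        refine Finset.card_le_card fun p hp => ?_
        obtain ⟨i, -, rfl⟩ := Finset.mem_image.1 hp
        have h1 : i ≠ σ i := fun h => by
          have := congrArg Fin.val h
          simp only [σ] at this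
          omega
        have h2 : (σ i : ℕ) / 2 = (i : ℕ) / 2 := by simp only [σ]; omega
        exact Finset.mem_filter.2 ⟨Finset.mem_univ _, h1, by simp [doubledSeq, h2, hr]⟩

/-- Replacing the first index of any pair by its twin changes the multiset of indices but not the
sum. -/
theorem le_foldCount_two_doubledSeq (x : ℕ → UnitAddCircle) (M : ℕ) {r : ℝ} (hr : 0 ≤ r) :
    (2 * M) ^ 2 ≤ foldCount 2 (doubledSeq x) (2 * M) r := by
  classical
  let σ : Fin (2 * M) → Fin (2 * M) := fun i =>
    ⟨2 * ((i : ℕ) / 2) + (1 - (i : ℕ) % 2), by have := i.2; omega⟩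
  have hσ : ∀ i, σ i ≠ i := fun i h => by
    have := congrArg Fin.val h
    simp only [σ] at this
    omega
  have hσ2 : ∀ i, (σ i : ℕ) / 2 = (i : ℕ) / 2 := fun i => by simp only [σ]; omega
  let F : (Fin 2 → Fin (2 * M)) → (Fin 2 → Fin (2 * M)) × (Fin 2 → Fin (2 * M)) := fun a =>
    (a, ![σ (a 0), a 1])
  have hinj : Function.Injective F := fun a b h => congrArg Prod.fst h
  calc (2 * M) ^ 2 = (Finset.univ.image F).card := by
        rw [Finset.card_image_of_injective _ hinj, Finset.card_univ]
        simp
    _ ≤ _ := by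
        refine Finset.card_le_card fun p hp => ?_
        obtain ⟨a, -, rfl⟩ := Finset.mem_image.1 hp
        refine Finset.mem_filter.2 ⟨Finset.mem_univ _, fun h => ?_, ?_⟩
        · have huniv : (Finset.univ : Finset (Fin 2)).val = 0 ::ₘ {1} := rfl
          simp [huniv, F, Multiset.map_cons] at h
          exact hσ _ h.symm
        · simp [F, doubledSeq, hσ2, hr]
theorem mainTheorem8 {Ω : Type*} [MeasurableSpace Ω] (μ : Measure Ω) [IsProbabilityMeasure μ]
    (X : ℕ → Ω → UnitAddCircle)
    (hindep : iIndepFun X μ)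
    (hunif : ∀ n, HasLaw (X n) (volume : Measure UnitAddCircle) μ) :
    (∀ ω, ¬ HasPoissonianPairCorrelation (doubledSeq fun n => X n ω)) ∧
    (∀ ω, ¬ HasPoissonianFoldCorrelation 2 2 (doubledSeq fun n => X n ω)) ∧
    (∀ᵐ ω ∂μ, HasPoissonianFoldCorrelation 2 1 (doubledSeq fun n => X n ω)) := by
  have heven : Tendsto (fun M : ℕ => 2 * M) atTop atTop :=
    tendsto_id.const_mul_atTop' two_pos
  refine ⟨fun ω h => ?_, fun ω h => ?_, ?_⟩
  · have hle := ge_of_tendsto ((h (1 / 4) (by norm_num)).comp heven) (b := 1) (by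
      filter_upwards [eventually_gt_atTop 0] with M hM
      have hM' : (0 : ℝ) < ((2 * M : ℕ) : ℝ) := by exact_mod_cast Nat.mul_pos two_pos hM
      have hcount := le_pairCount_doubledSeq (fun n => X n ω) M
        (r := 1 / 4 / ((2 * M : ℕ) : ℝ)) (by positivity)
      rw [Function.comp_apply, one_div_mul_eq_div, one_le_div hM']
      exact_mod_cast hcount)
    norm_num at hle
  · have hle := ge_of_tendsto ((h (1 / 4) (by norm_num)).comp heven) (b := 1) (by
      filter_upwards [eventually_gt_atTop 0] with M hM
      have hM' : (0 : ℝ) < ((2 * M : ℕ) : ℝ) := by exact_mod_cast Nat.mul_pos two_pos hM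
      have hcount := le_foldCount_two_doubledSeq (fun n => X n ω) M
        (r := 1 / 4 / ((2 * M : ℕ) : ℝ) ^ (2 : ℝ)) (by positivity)
      have hpow : ((2 * M : ℕ) : ℝ) ^ (2 * ((2 : ℕ) : ℝ) - 2) = ((2 * M : ℕ) : ℝ) ^ 2 := by
        rw [← Real.rpow_natCast]
        norm_num
      rw [Function.comp_apply, hpow, one_div_mul_eq_div, one_le_div (by positivity)]
      exact_mod_cast hcount)
    norm_num at hle
  · have hall : ∀ᵐ ω ∂μ, ∀ q : ℚ, 0 < q →
        Tendsto (fun N : ℕ => (1 / (N : ℝ) ^ (2 * ((2 : ℕ) : ℝ) - 1)) *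
          (foldCount 2 (doubledSeq fun n => X n ω) N ((q : ℝ) / (N : ℝ) ^ (1 : ℝ)) : ℝ))
          atTop (𝓝 (2 * q)) := by
      -- Countability of `ℚ` lets the quantifier over `q` move inside the almost sure statement.
      rw [ae_all_iff]
      intro q
      by_cases hq : 0 < q
      · filter_upwards [ae_tendsto_foldCount_doubledSeq hindep hunif
          (s := q) (by exact_mod_cast hq)] with ω hω _ using hω
      · exact Eventually.of_forall fun ω h => absurd h hq
    filter_upwards [hall] with ω hω using hasPoissonianFoldCorrelation_of_rat hω
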